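/- For $n\ge 1$ let $\mathcal S_n(1324,2134)$ be the set of permutations of $\{1,\dots,n\}$ that avoid both patterns $1324$ and $2134$, and for $1\le \ell\le n$ let $s_{n,\ell}$ be the number of $\sigma\in\mathcal S_n(1324,2134)$ with $\sigma(n)=\ell$. Then the generating function $h(x,u)=\sum_{n\ge 1}\sum_{\ell=1}^{n}s_{n,\ell}\,u^\ell x^n$, a formal power series in $x$ with coefficients in $\mathbb{Q}[u]$, is given by \[ h(x,u)=\frac{2ux(1-u)(1-ux)+ux\bigl(1-u(1-u)x\bigr)\bigl(1-x-\sqrt{1-6x+x^2}\bigr)}{2\bigl(1-u(1+x)+2u^2x\bigr)}, \] where $\sqrt{1-6x+x^2}$ denotes the formal power series with constant term $1$ whose square is $1-6x+x^2$, and the fraction is taken in the field of fractions of $\mathbb{Q}[u][[x]]$. In particular, \[ h(x,1)=\frac{1-x-\sqrt{1-6x+x^2}}{2}, \] and hence $|\mathcal S_n(1324,2134)|=L_{n-1}$ for all $n\ge 1$, where $(L_n)_{n\ge0}=1,2,6,22,90,\dots$ are the large Schröder numbers, given by $L_0=1$ and $L_{n+1}=L_n+\sum_{i=0}^{n}L_iL_{n-i}$.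 -/

import Mathlib

noncomputable section

open scoped Polynomial PowerSeries

namespace LastEntry

/-- A permutation `σ` of `n` letters contains the pattern `p` (a word of length `k` in one-line
notation) if `σ` has a subsequence, at positions `f 0 < f 1 < ⋯`, which is order-isomorphic
to `p`. -/
def Contains {n k : ℕ} (σ : Equiv.Perm (Fin n)) (p : Fin k → ℕ) : Prop :=
  ∃ f : Fin k → Fin n, StrictMono f ∧ ∀ i j : Fin k, σ (f i) < σ (f j) ↔ p i < p j

/-- The set of permutations of `n` letters avoiding both `1324` and `2134`. -/
def avoiders (n : ℕ) : Set (Equiv.Perm (Fin n)) :=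
  {σ | ¬ Contains σ ![1, 3, 2, 4] ∧ ¬ Contains σ ![2, 1, 3, 4]}

/-- The `(1324, 2134)`-avoiders of size `n` whose last entry (at position `n`) is `ℓ`. Positions and
entries are numbered from `1`, so that `i : Fin n` stands for the number `i + 1`. -/
def avoidersLast (n ℓ : ℕ) : Set (Equiv.Perm (Fin n)) :=
  {σ | σ ∈ avoiders n ∧ ∃ i : Fin n, (i : ℕ) + 1 = n ∧ (σ i : ℕ) + 1 = ℓ}

/-- The number `s_{n,ℓ}` of `(1324, 2134)`-avoiders of size `n` with last entry `ℓ`. -/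
def lastCount (n ℓ : ℕ) : ℕ := (avoidersLast n ℓ).ncard

/-- The generating function `h(x,u) = ∑_{n ≥ 1} ∑_{ℓ = 1}^{n} s_{n,ℓ} u^ℓ x^n`, as a formal power
series in `x` whose coefficients are polynomials in `u`. -/
def h : ℚ[X]⟦X⟧ :=
  PowerSeries.mk fun n => ∑ ℓ ∈ Finset.Icc 1 n, (lastCount n ℓ : ℚ[X]) * Polynomial.X ^ ℓ

/-- `h(x,1)`, the specialization of `h` at `u = 1`. -/
def hAtOne : ℚ⟦X⟧ := PowerSeries.map (Polynomial.evalRingHom (1 : ℚ)) h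

/-- The variable `x` of `ℚ[u][[x]]`. -/
def x : ℚ[X]⟦X⟧ := PowerSeries.X

/-- The variable `u` of `ℚ[u][[x]]`. -/
def u : ℚ[X]⟦X⟧ := PowerSeries.C (Polynomial.X : ℚ[X])

/-- A power series in `x` alone, viewed in `ℚ[u][[x]]`. -/
def inX (f : ℚ⟦X⟧) : ℚ[X]⟦X⟧ := PowerSeries.map (Polynomial.C : ℚ →+* ℚ[X]) f

/-- The fraction `a / b` of two elements of the integral domain `ℚ[u][[x]]`, in its field of
fractions. -/
def frac (a b : ℚ[X]⟦X⟧) : FractionRing ℚ[X]⟦X⟧ :=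
  algebraMap ℚ[X]⟦X⟧ (FractionRing ℚ[X]⟦X⟧) a / algebraMap ℚ[X]⟦X⟧ (FractionRing ℚ[X]⟦X⟧) b

end LastEntry

end

open scoped Polynomial PowerSeries

namespace LastEntry

/-! Permutations are grown by appending a last entry. Both patterns end in their largest letter, so
an entry `m` may be appended to an avoider exactly when the entries below `m` avoid 132 and 213
(`Good σ m`, `append_mem_avoiders_iff`). Hence `appendCount n m` is the number of avoiders with a
prescribed last entry, and the problem is to see how `Good` evolves. If `r` is positive and the
entries below `r` avoid 132 and 213, exactly two values `m ≤ r` can be appended so that the entries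
below `r + 1` still do (`Good.card_fits`); for `m > r` nothing below `r + 1` changes. This gives the
recurrence `appendCount_succ`, which becomes the functional equation `kernel_mul_appendSeries`, with
kernel `1 - u(1+x) + 2u²x`. The kernel factors as `(1 - uα)(1 - u(1+x-α))`, where `α = 1 - xS` and
`S` is the large Schröder series. Cancelling the kernel at `u = 1/α` determines the series of all
avoiders as `1 + xS` (`avoiderSeries_eq`), and the functional equation then yields `h`. -/

theorem contains_1324_iff {n : ℕ} (σ : Equiv.Perm (Fin n)) :
    Contains σ ![1, 3, 2, 4] ↔
      ∃ a b c d, a < b ∧ b < c ∧ c < d ∧ σ a < σ c ∧ σ c < σ b ∧ σ b < σ d := by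
  constructor
  · rintro ⟨f, hf, h⟩
    exact ⟨f 0, f 1, f 2, f 3, hf (by decide), hf (by decide), hf (by decide),
      (h 0 2).2 (by simp), (h 2 1).2 (by simp), (h 1 3).2 (by simp)⟩
  · rintro ⟨a, b, c, d, hab, hbc, hcd, h1, h2, h3⟩
    refine ⟨![a, b, c, d], ?_, ?_⟩
    · rw [Fin.strictMono_iff_lt_succ]
      intro i
      fin_cases i <;> simpa
    · intro i j
      fin_cases i <;> fin_cases j <;> simp <;> order

theorem contains_2134_iff {n : ℕ} (σ : Equiv.Perm (Fin n)) :
    Contains σ ![2, 1, 3, 4] ↔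
      ∃ a b c d, a < b ∧ b < c ∧ c < d ∧ σ b < σ a ∧ σ a < σ c ∧ σ c < σ d := by
  constructor
  · rintro ⟨f, hf, h⟩
    exact ⟨f 0, f 1, f 2, f 3, hf (by decide), hf (by decide), hf (by decide),
      (h 1 0).2 (by simp), (h 0 2).2 (by simp), (h 2 3).2 (by simp)⟩
  · rintro ⟨a, b, c, d, hab, hbc, hcd, h1, h2, h3⟩
    refine ⟨![a, b, c, d], ?_, ?_⟩
    · rw [Fin.strictMono_iff_lt_succ]
      intro i
      fin_cases i <;> simpa
    · intro i j
      fin_cases i <;> fin_cases j <;> simp <;> order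

/-! ### Avoidance of 132 and 213 among the small entries -/

/-- The entries of `σ` smaller than `r` (counted from `0`) avoid both `132` and `213`. -/
def Good {n : ℕ} (σ : Equiv.Perm (Fin n)) (r : ℕ) : Prop :=
  ∀ a b c, a < b → b < c → (σ a : ℕ) < r → (σ b : ℕ) < r → (σ c : ℕ) < r →
    ¬ (σ a < σ c ∧ σ c < σ b) ∧ ¬ (σ b < σ a ∧ σ a < σ c)

theorem Good.mono {n : ℕ} {σ : Equiv.Perm (Fin n)} {r s : ℕ} (h : Good σ s) (hrs : r ≤ s) :
    Good σ r := fun a b c hab hbc ha hb hc =>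
  h a b c hab hbc (ha.trans_le hrs) (hb.trans_le hrs) (hc.trans_le hrs)

theorem good_of_le_two {n : ℕ} (σ : Equiv.Perm (Fin n)) {r : ℕ} (hr : r ≤ 2) : Good σ r := by
  intro a b c _ _ ha hb hc
  simp only [Fin.lt_def]
  omega

theorem mem_avoiders_iff {n : ℕ} (σ : Equiv.Perm (Fin n)) :
    σ ∈ avoiders n ↔ ∀ d, ∀ a b c, a < b → b < c → c < d →
      ¬ (σ a < σ c ∧ σ c < σ b ∧ σ b < σ d) ∧ ¬ (σ b < σ a ∧ σ a < σ c ∧ σ c < σ d) := by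
  simp only [avoiders, Set.mem_ofPred_eq, contains_1324_iff, contains_2134_iff]
  constructor
  · rintro ⟨h1, h2⟩ d a b c hab hbc hcd
    exact ⟨fun h => h1 ⟨a, b, c, d, hab, hbc, hcd, h⟩, fun h => h2 ⟨a, b, c, d, hab, hbc, hcd, h⟩⟩
  · intro h
    refine ⟨?_, ?_⟩ <;> rintro ⟨a, b, c, d, hab, hbc, hcd, h'⟩
    · exact (h d a b c hab hbc hcd).1 h'
    · exact (h d a b c hab hbc hcd).2 h'

/-! ### Appending a last entry -/

/-- The permutation obtained from `σ` by appending the entry `m` at the end, after increasing by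
one the entries that are at least `m`. -/
def append {n : ℕ} (m : Fin (n + 1)) (σ : Equiv.Perm (Fin n)) : Equiv.Perm (Fin (n + 1)) :=
  (finSuccEquiv' (Fin.last n)).trans ((Equiv.optionCongr σ).trans (finSuccEquiv' m).symm)

@[simp]
theorem append_last {n : ℕ} (m : Fin (n + 1)) (σ : Equiv.Perm (Fin n)) :
    append m σ (Fin.last n) = m := by
  simp [append]

@[simp]
theorem append_castSucc {n : ℕ} (m : Fin (n + 1)) (σ : Equiv.Perm (Fin n)) (i : Fin n) :
    append m σ i.castSucc = m.succAbove (σ i) := by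
  rw [← Fin.succAbove_last_apply]
  simp only [append, Equiv.trans_apply, finSuccEquiv'_succAbove, Equiv.optionCongr_apply,
    Option.map_some, finSuccEquiv'_symm_some]

theorem append_injective {n : ℕ} (m : Fin (n + 1)) : Function.Injective (append m) := by
  intro σ τ h
  ext i
  have := congrArg (fun ρ => ρ i.castSucc) h
  simp only [append_castSucc] at this
  rw [Fin.succAbove_right_injective this]

theorem append_bijective (n : ℕ) :
    Function.Bijective (fun p : Fin (n + 1) × Equiv.Perm (Fin n) => append p.1 p.2) := by
  rw [Fintype.bijective_iff_injective_and_card]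
  refine ⟨?_, by simp [Fintype.card_perm, Nat.factorial_succ]⟩
  rintro ⟨m, σ⟩ ⟨m', σ'⟩ h
  have hm : m = m' := by simpa using congrArg (fun ρ => ρ (Fin.last n)) h
  subst hm
  rw [append_injective m (show append m σ = append m σ' from h)]

theorem val_succAbove {n : ℕ} (m : Fin (n + 1)) (i : Fin n) :
    (m.succAbove i : ℕ) = if (i : ℕ) < m then (i : ℕ) else i + 1 := by
  simp only [Fin.succAbove, Fin.lt_def, Fin.val_castSucc]
  split_ifs <;> simp

/-- In an occurrence using the last position, the new entry plays the letter 4, so the other three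
letters form a 132 or a 213 below `m`. -/
theorem append_mem_avoiders_iff {n : ℕ} (m : Fin (n + 1)) (σ : Equiv.Perm (Fin n)) :
    append m σ ∈ avoiders (n + 1) ↔ σ ∈ avoiders n ∧ Good σ m := by
  have key : ∀ i : Fin n, m.succAbove i < m ↔ (i : ℕ) < m := fun i => by
    rw [Fin.succAbove_lt_iff_castSucc_lt, Fin.lt_def, Fin.val_castSucc]
  rw [mem_avoiders_iff, mem_avoiders_iff, Fin.forall_fin_succ']
  constructor
  · rintro ⟨h1, h2⟩
    refine ⟨fun d a b c hab hbc hcd => ?_, fun a b c hab hbc ha hb hc => ?_⟩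
    · simpa using h1 d a.castSucc b.castSucc c.castSucc (by simpa) (by simpa) (by simpa)
    · have := h2 a.castSucc b.castSucc c.castSucc (by simpa) (by simpa) (Fin.castSucc_lt_last c)
      simpa [key, ha, hb, hc] using this
  · rintro ⟨h1, h2⟩
    refine ⟨fun d a b c hab hbc hcd => ?_, fun a b c hab hbc hcd => ?_⟩
    all_goals
      obtain ⟨c, rfl⟩ := Fin.exists_castSucc_eq.2 (hcd.trans_le (Fin.le_last _)).ne
      obtain ⟨b, rfl⟩ := Fin.exists_castSucc_eq.2 (hbc.trans_le (Fin.le_last _)).ne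
      obtain ⟨a, rfl⟩ := Fin.exists_castSucc_eq.2 (hab.trans_le (Fin.le_last _)).ne
    · simpa using h1 d a b c (by simpa using hab) (by simpa using hbc) (by simpa using hcd)
    · have := h2 a b c (by simpa using hab) (by simpa using hbc)
      simp only [append_castSucc, append_last, Fin.succAbove_lt_succAbove_iff, key]
      simp only [Fin.lt_def] at this ⊢
      refine ⟨fun h => (this ?_ ?_ ?_).1 ⟨h.1, h.2.1⟩, fun h => (this ?_ ?_ ?_).2 ⟨h.1, h.2.1⟩⟩ <;>
        omega

/-- Entries below `r ≤ m` are not shifted, and the new entry is not among them. -/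
theorem good_append_of_le {n : ℕ} {m : Fin (n + 1)} {σ : Equiv.Perm (Fin n)} {r : ℕ}
    (h : Good σ m) (hr : r ≤ m) : Good (append m σ) r := by
  intro a b c hab hbc ha hb hc
  obtain ⟨b, rfl⟩ := Fin.exists_castSucc_eq.2 (hbc.trans_le (Fin.le_last _)).ne
  obtain ⟨a, rfl⟩ := Fin.exists_castSucc_eq.2 (hab.trans_le (Fin.le_last _)).ne
  induction c using Fin.lastCases with
  | last => simp at hc; omega
  | cast c =>
    have := h a b c (by simpa using hab) (by simpa using hbc)
    simp only [append_castSucc, val_succAbove] at ha hb hc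
    simp only [append_castSucc, Fin.succAbove_lt_succAbove_iff]
    apply this <;> grind

/-! ### The two values that can be appended -/

/-- The entry `m` may be appended to `σ` so that no new `132` or `213` arises below `r + 1`. -/
def Fits {n : ℕ} (σ : Equiv.Perm (Fin n)) (r m : ℕ) : Prop :=
  (∀ a b, a < b → (σ a : ℕ) < m → ¬ σ b < σ a) ∧
    ∀ a b, a < b → (σ a : ℕ) < m → (σ b : ℕ) < r → ¬ m ≤ (σ b : ℕ)

/-- The entries below `r + 1` are those formerly below `r` together with `m`. As last letter, `m` is
the 3 of a 213 or the 2 of a 132; the two clauses of `Fits` exclude these in that order. -/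
theorem good_append_iff {n : ℕ} {m : Fin (n + 1)} {σ : Equiv.Perm (Fin n)} {r : ℕ}
    (hr : (m : ℕ) ≤ r) : Good (append m σ) (r + 1) ↔ Good σ r ∧ Fits σ r m := by
  have key : ∀ i : Fin n, m.succAbove i < m ↔ (i : ℕ) < m := fun i => by
    rw [Fin.succAbove_lt_iff_castSucc_lt, Fin.lt_def, Fin.val_castSucc]
  have key' : ∀ i : Fin n, m < m.succAbove i ↔ (m : ℕ) ≤ i := fun i => by
    rw [Fin.lt_succAbove_iff_le_castSucc, Fin.le_def, Fin.val_castSucc]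
  have key2 : ∀ i : Fin n, (m.succAbove i : ℕ) < r + 1 ↔ (i : ℕ) < r := fun i => by
    rw [val_succAbove]; split_ifs <;> omega
  constructor
  · intro h
    refine ⟨fun a b c hab hbc ha hb hc => ?_, fun a b hab ha hba => ?_, fun a b hab ha hb hm => ?_⟩
    · have := h a.castSucc b.castSucc c.castSucc (by simpa) (by simpa)
      simp only [append_castSucc, Fin.succAbove_lt_succAbove_iff, key2] at this
      exact this ha hb hc
    all_goals
      have := h a.castSucc b.castSucc (Fin.last n) (by simpa) (Fin.castSucc_lt_last b)
      simp only [append_castSucc, append_last, Fin.succAbove_lt_succAbove_iff, key, key', key2]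
        at this
      simp only [Fin.lt_def] at *
      grind
  · rintro ⟨h, h1, h2⟩ a b c hab hbc ha hb hc
    obtain ⟨b, rfl⟩ := Fin.exists_castSucc_eq.2 (hbc.trans_le (Fin.le_last _)).ne
    obtain ⟨a, rfl⟩ := Fin.exists_castSucc_eq.2 (hab.trans_le (Fin.le_last _)).ne
    have hab' : a < b := by simpa using hab
    induction c using Fin.lastCases with
    | last =>
      simp only [append_castSucc, append_last, Fin.succAbove_lt_succAbove_iff, key, key', key2]
        at ha hb hc ⊢
      exact ⟨fun h' => h2 a b hab' h'.1 hb h'.2, fun h' => h1 a b hab' h'.2 h'.1⟩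
    | cast c =>
      simp only [append_castSucc, Fin.succAbove_lt_succAbove_iff, key2] at ha hb hc ⊢
      exact h a b c hab' (by simpa using hbc) ha hb hc

theorem fits_zero {n : ℕ} (σ : Equiv.Perm (Fin n)) (r : ℕ) : Fits σ r 0 := by
  constructor <;> simp

/-- For `m < k`, compare the positions of the entries `0` and `m`. If `0` comes first, then `0`, `m`
and the appended `m` form a 132; otherwise `m`, `0` and the appended `k` form a 213. -/
theorem Fits.eq_of_pos {n : ℕ} {σ : Equiv.Perm (Fin n)} {r m k : ℕ} (hr : r ≤ n)
    (hm : Fits σ r m) (hk : Fits σ r k) (hm0 : 0 < m) (hk0 : 0 < k) (hmr : m ≤ r) (hkr : k ≤ r) :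
    m = k := by
  have main : ∀ {m k : ℕ}, Fits σ r m → Fits σ r k → 0 < m → k ≤ r → ¬ m < k := by
    intro m k hm hk hm0 hkr hlt
    set p := σ.symm ⟨0, by omega⟩ with hp
    set q := σ.symm ⟨m, by omega⟩ with hq
    have hσp : (σ p : ℕ) = 0 := by simp [hp]
    have hσq : (σ q : ℕ) = m := by simp [hq]
    rcases lt_trichotomy p q with h | h | h
    · exact hm.2 p q h (by omega) (by omega) (by omega)
    · rw [h] at hσp; omega
    · exact hk.1 q p h (by omega) (by rw [Fin.lt_def]; omega)
  exact le_antisymm (not_lt.1 (main hk hm hk0 hmr)) (not_lt.1 (main hm hk hm0 hkr))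

theorem Good.exists_fits {n : ℕ} {σ : Equiv.Perm (Fin n)} {r : ℕ} (hr : r ≤ n) (hr0 : 0 < r)
    (h : Good σ r) : ∃ m, 0 < m ∧ m ≤ r ∧ Fits σ r m := by
  classical
  -- The value sought is the least positive entry below `r` standing before the entry `0`, or `r` if
  -- there is none. By minimality every entry below it stands at or after `0`.
  have ex : ∃ m, 0 < m ∧ (m = r ∨ ∃ hm : m < n, m < r ∧
      σ.symm ⟨m, hm⟩ < σ.symm ⟨0, by omega⟩) := ⟨r, hr0, Or.inl rfl⟩
  set p := σ.symm ⟨0, by omega⟩ with hp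
  have hσp : (σ p : ℕ) = 0 := by simp [hp]
  obtain ⟨hm0, hm⟩ := Nat.find_spec ex
  have hafter : ∀ a, (σ a : ℕ) < Nat.find ex → p ≤ a := by
    intro a ha
    by_contra! hlt
    have ha0 : (σ a : ℕ) ≠ 0 := fun h0 => by
      have : σ a = σ p := Fin.ext (by omega)
      exact hlt.ne (σ.injective this)
    refine Nat.find_min ex ha ⟨by omega, Or.inr ⟨(σ a).2, ?_, by simpa using hlt⟩⟩
    rcases hm with h' | ⟨_, h', _⟩ <;> omega
  have hmr : Nat.find ex ≤ r := by
    rcases hm with h' | ⟨_, h', _⟩ <;> omega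
  refine ⟨Nat.find ex, hm0, hmr, fun a b hab ha hba => ?_, fun a b hab ha hb hmb => ?_⟩
  · have hpa := hafter a ha
    have hba' : (σ b : ℕ) < σ a := hba
    rcases hpa.eq_or_lt with rfl | hpa
    · omega
    -- A descent starting below the chosen value would complete a 132 whose 1 is the entry `0`.
    · refine (h p a b hpa hab (by omega) (by omega) (by omega)).1 ⟨?_, hba⟩
      have : σ b ≠ σ p := fun e => (hpa.trans hab).ne' (σ.injective e)
      have := Fin.val_ne_of_ne this
      rw [Fin.lt_def]; omega
  · have hpa := hafter a ha
    rcases hm with h' | ⟨hmn, h', hlt⟩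
    · omega
    · set z := σ.symm ⟨Nat.find ex, hmn⟩ with hz
      have hσz : (σ z : ℕ) = Nat.find ex := by simp [hz]
      have hzb : σ z ≠ σ b := fun e => ((hlt.trans_le hpa).trans hab).ne (σ.injective e)
      have := Fin.val_ne_of_ne hzb
      -- The chosen value, then `0`, then the larger entry at `b` form a 213 below `r`.
      refine (h z p b hlt (hpa.trans_lt hab) (by omega) (by omega) hb).2 ⟨?_, ?_⟩ <;>
        rw [Fin.lt_def] <;> omega

open Classical in
theorem Good.card_fits {n : ℕ} {σ : Equiv.Perm (Fin n)} {r : ℕ} (hr : r ≤ n) (hr0 : 0 < r)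
    (h : Good σ r) : ((Finset.range (r + 1)).filter (Fits σ r)).card = 2 := by
  obtain ⟨m, hm0, hmr, hm⟩ := h.exists_fits hr hr0
  rw [Finset.card_eq_two]
  refine ⟨0, m, hm0.ne, ?_⟩
  ext k
  simp only [Finset.mem_filter, Finset.mem_range, Finset.mem_insert, Finset.mem_singleton]
  constructor
  · rintro ⟨hk, hf⟩
    rcases Nat.eq_zero_or_pos k with hk0 | hk0
    · exact Or.inl hk0
    · exact Or.inr (hf.eq_of_pos hr hm hk0 hm0 (by omega) hmr)
  · rintro (rfl | rfl)
    · exact ⟨by omega, fits_zero σ r⟩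
    · exact ⟨by omega, hm⟩

/-! ### The recurrence for the counts -/

open Classical in
/-- The number of avoiders of size `n` to which the entry `m` (counted from `0`) may be appended. -/
noncomputable def appendCount (n m : ℕ) : ℕ :=
  (Finset.univ.filter fun σ : Equiv.Perm (Fin n) => σ ∈ avoiders n ∧ Good σ m).card

theorem avoidersLast_succ {n : ℕ} (m : Fin (n + 1)) :
    avoidersLast (n + 1) (m + 1) = append m '' {σ | σ ∈ avoiders n ∧ Good σ m} := by
  ext τ
  obtain ⟨⟨k, σ⟩, rfl⟩ := (append_bijective n).2 τ
  simp only [avoidersLast, Set.mem_ofPred_eq, Set.mem_image]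
  constructor
  · rintro ⟨h, i, hi, hik⟩
    obtain rfl : i = Fin.last n := Fin.ext (by simp; omega)
    obtain rfl : k = m := Fin.ext (by simpa using hik)
    exact ⟨σ, (append_mem_avoiders_iff _ _).1 h, rfl⟩
  · rintro ⟨σ', h, e⟩
    rw [← e]
    exact ⟨(append_mem_avoiders_iff _ _).2 h, Fin.last n, by simp, by simp⟩

theorem lastCount_succ {n m : ℕ} (hm : m ≤ n) : lastCount (n + 1) (m + 1) = appendCount n m := by
  classical
  have := avoidersLast_succ (⟨m, by omega⟩ : Fin (n + 1))
  rw [lastCount, this, Set.ncard_image_of_injective _ (append_injective _), appendCount,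
    ← Set.ncard_coe_finset]
  simp

theorem appendCount_of_le_two (n : ℕ) {m : ℕ} (hm : m ≤ 2) :
    appendCount n m = (avoiders n).ncard := by
  classical
  rw [appendCount, ← Set.ncard_coe_finset]
  simp [good_of_le_two _ hm]

open Classical in
theorem appendCount_succ_eq_sum (n s : ℕ) :
    appendCount (n + 1) s = ∑ m : Fin (n + 1), ∑ σ : Equiv.Perm (Fin n),
      if (σ ∈ avoiders n ∧ Good σ m) ∧ Good (append m σ) s then 1 else 0 := by
  rw [appendCount, Finset.card_filter, ← (append_bijective n).sum_comp, Fintype.sum_prod_type]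
  simp only [append_mem_avoiders_iff]

theorem ncard_avoiders_succ (n : ℕ) :
    (avoiders (n + 1)).ncard = ∑ m ∈ Finset.range (n + 1), appendCount n m := by
  classical
  rw [← appendCount_of_le_two (n + 1) (Nat.zero_le 2), appendCount_succ_eq_sum,
    ← Fin.sum_univ_eq_sum_range]
  simp only [appendCount, Finset.card_filter]
  refine Finset.sum_congr rfl fun m _ => Finset.sum_congr rfl fun σ _ => ?_
  simp [good_of_le_two (append m σ) (Nat.zero_le 2)]

/-- Split by the last entry `m`. Each `σ` that is good for `r` contributes its two fitting values `m
≤ r`; for `m > r`, goodness for `m` already suffices. Positivity of `r` matters: for `r = 0` the two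
fitting values would coincide. -/
theorem appendCount_succ {n r : ℕ} (hr0 : 0 < r) (hr : r ≤ n) :
    appendCount (n + 1) (r + 1) =
      2 * appendCount n r + ∑ m ∈ Finset.Ico (r + 1) (n + 1), appendCount n m := by
  classical
  let F : ℕ → ℕ := fun m => if m ≤ r then ∑ σ : Equiv.Perm (Fin n),
    if (σ ∈ avoiders n ∧ Good σ r) ∧ Fits σ r m then 1 else 0 else appendCount n m
  have key : ∀ m : Fin (n + 1), (∑ σ : Equiv.Perm (Fin n),
      if (σ ∈ avoiders n ∧ Good σ m) ∧ Good (append m σ) (r + 1) then 1 else 0) = F m := by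
    intro m
    dsimp only [F]
    split_ifs with h
    · refine Finset.sum_congr rfl fun σ _ => if_congr ?_ rfl rfl
      rw [good_append_iff h]
      exact ⟨fun ⟨⟨h1, _⟩, h2, h3⟩ => ⟨⟨h1, h2⟩, h3⟩, fun ⟨⟨h1, h2⟩, h3⟩ => ⟨⟨h1, h2.mono h⟩, h2, h3⟩⟩
    · rw [appendCount, Finset.card_filter]
      refine Finset.sum_congr rfl fun σ _ => if_congr ?_ rfl rfl
      exact ⟨fun h1 => h1.1, fun h1 => ⟨h1, good_append_of_le h1.2 (by omega)⟩⟩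
  rw [appendCount_succ_eq_sum, Finset.sum_congr rfl fun m _ => key m, Fin.sum_univ_eq_sum_range F,
    Finset.range_eq_Ico, ← Finset.sum_Ico_consecutive _ (Nat.zero_le (r + 1)) (by omega)]
  congr 1
  · rw [← Finset.range_eq_Ico, Finset.sum_congr rfl fun m hm =>
      if_pos (Nat.lt_succ_iff.1 (Finset.mem_range.1 hm)), Finset.sum_comm, appendCount,
      Finset.card_filter, Finset.mul_sum]
    refine Finset.sum_congr rfl fun σ _ => ?_
    by_cases h : σ ∈ avoiders n ∧ Good σ r
    · simp only [h, true_and, and_self, if_true]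
      rw [← Finset.card_filter, h.2.card_fits hr hr0, mul_one]
    · simp [h]
  · refine Finset.sum_congr rfl fun m hm => if_neg ?_
    have := Finset.mem_Ico.1 hm
    omega

/-! ### Generating functions and the functional equation -/

/-- The generating polynomial of the number of ways to append an entry to an avoider of size `n`. -/
noncomputable def appendPoly (n : ℕ) : ℚ[X] :=
  ∑ m ∈ Finset.range (n + 1), (appendCount n m : ℚ[X]) * Polynomial.X ^ m

theorem eval_one_appendPoly (n : ℕ) :
    (appendPoly n).eval 1 = ((avoiders (n + 1)).ncard : ℚ) := by
  simp [appendPoly, Polynomial.eval_finsetSum, ncard_avoiders_succ]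

theorem ncard_avoiders_zero : (avoiders 0).ncard = 1 := by
  have : avoiders 0 = {1} := by
    ext σ
    simp [mem_avoiders_iff, Subsingleton.elim σ 1]
  rw [this, Set.ncard_singleton]

theorem appendPoly_zero : appendPoly 0 = 1 := by
  simp [appendPoly, appendCount_of_le_two, ncard_avoiders_zero]

-- Exchanging the double sum of the recurrence leaves finite geometric sums in `X`, which the factor
-- `1 - X` telescopes.
open Polynomial in
theorem one_sub_X_mul_appendPoly_succ (n : ℕ) :
    (1 - X) * appendPoly (n + 1) + (2 * X ^ 2 - X) * appendPoly n =
      ((avoiders (n + 1)).ncard : ℚ[X]) - (X - X ^ 2) * ((avoiders n).ncard : ℚ[X]) := by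
  set t : ℕ → ℚ[X] := fun m => (appendCount n m : ℚ[X]) with ht
  have ht0 : t 0 = ((avoiders n).ncard : ℚ[X]) := by
    simp [ht, appendCount_of_le_two]
  have hN : ((avoiders (n + 1)).ncard : ℚ[X]) = (∑ m ∈ Finset.range n, t (m + 1)) + t 0 := by
    rw [ncard_avoiders_succ, Nat.cast_sum, Finset.sum_range_succ']
  have hG : appendPoly n = (∑ m ∈ Finset.range n, t (m + 1) * X ^ (m + 1)) + t 0 := by
    rw [appendPoly, Finset.sum_range_succ']
    simp [ht]
  -- The recurrence starts at exponent 2; at exponents 0 and 1 goodness is automatic, which gives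
  -- the factor `1 + X`.
  have hG' : appendPoly (n + 1) = ((avoiders (n + 1)).ncard : ℚ[X]) * (1 + X) +
      ∑ r ∈ Finset.range n, (2 * t (r + 1) + ∑ m ∈ Finset.Ico (r + 1) n, t (m + 1)) *
        X ^ (r + 2) := by
    rw [appendPoly, Finset.sum_range_succ', Finset.sum_range_succ']
    rw [Finset.sum_congr rfl fun r hr => by
      rw [appendCount_succ (Nat.succ_pos r) (Finset.mem_range.1 hr),
        ← Finset.sum_Ico_add' (fun m => appendCount n m) (r + 1) n 1]]
    simp only [appendCount_of_le_two (n + 1) (show 0 ≤ 2 by omega),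
      appendCount_of_le_two (n + 1) (show 0 + 1 ≤ 2 by omega), ht]
    push_cast
    ring
  have hswap : ∑ r ∈ Finset.range n, (∑ m ∈ Finset.Ico (r + 1) n, t (m + 1)) * X ^ (r + 2) =
      ∑ m ∈ Finset.range n, t (m + 1) * (X ^ 2 * ∑ r ∈ Finset.range m, X ^ r) := by
    simp only [Finset.sum_mul, Finset.mul_sum]
    rw [Finset.sum_sigma', Finset.sum_sigma']
    refine Finset.sum_bij' (fun p _ => ⟨p.2, p.1⟩) (fun p _ => ⟨p.2, p.1⟩) ?_ ?_ ?_ ?_ ?_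
    · rintro ⟨a, b⟩ h
      simp at h ⊢
      omega
    · rintro ⟨a, b⟩ h
      simp at h ⊢
      omega
    · simp
    · simp
    · intro p _
      ring
  have hgeom : ∀ m, (1 - X) * (X ^ 2 * ∑ r ∈ Finset.range m, X ^ r) =
      X ^ 2 - (X : ℚ[X]) * X ^ (m + 1) := fun m => by
    have := mul_neg_geom_sum (X : ℚ[X]) m
    linear_combination X ^ 2 * this
  have hsum : (1 - X) * ∑ m ∈ Finset.range n, t (m + 1) * (X ^ 2 * ∑ r ∈ Finset.range m, X ^ r) =
      X ^ 2 * (∑ m ∈ Finset.range n, t (m + 1)) -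
        X * ∑ m ∈ Finset.range n, t (m + 1) * X ^ (m + 1) := by
    rw [Finset.mul_sum, Finset.mul_sum, Finset.mul_sum, ← Finset.sum_sub_distrib]
    refine Finset.sum_congr rfl fun m _ => ?_
    linear_combination t (m + 1) * hgeom m
  have hlin : ∑ r ∈ Finset.range n, 2 * t (r + 1) * X ^ (r + 2) =
      2 * X * ∑ m ∈ Finset.range n, t (m + 1) * X ^ (m + 1) := by
    rw [Finset.mul_sum]
    exact Finset.sum_congr rfl fun m _ => by ring
  rw [hG', hG, ← ht0]
  simp only [add_mul, Finset.sum_add_distrib]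
  rw [hlin, hswap]
  rw [hN]
  linear_combination hsum

/-- The generating function of all avoiders by size, the empty permutation included. -/
noncomputable def avoiderSeries : ℚ⟦X⟧ := PowerSeries.mk fun n => ((avoiders n).ncard : ℚ)

/-- The generating function of the polynomials `appendPoly n`. -/
noncomputable def appendSeries : ℚ[X]⟦X⟧ := PowerSeries.mk appendPoly

theorem h_eq : h = u * x * appendSeries := by
  ext1 n
  rw [h, u, x, mul_assoc, PowerSeries.coeff_C_mul, PowerSeries.coeff_mk]
  cases n with
  | zero => simp
  | succ n =>
    rw [PowerSeries.coeff_succ_X_mul, appendSeries, PowerSeries.coeff_mk, appendPoly,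
      ← Finset.Ico_add_one_right_eq_Icc, Finset.mul_sum, Finset.sum_Ico_eq_sum_range]
    refine Finset.sum_congr (by simp) fun m hm => ?_
    rw [add_comm 1 m, lastCount_succ (Nat.lt_succ_iff.1 (Finset.mem_range.1 hm))]
    ring

theorem hAtOne_eq : hAtOne = avoiderSeries - 1 := by
  ext n
  rw [hAtOne, h_eq, avoiderSeries]
  cases n with
  | zero => simp [u, x, ncard_avoiders_zero]
  | succ n =>
    rw [PowerSeries.coeff_map, u, x, mul_assoc, PowerSeries.coeff_C_mul,
      PowerSeries.coeff_succ_X_mul]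
    simp [appendSeries, eval_one_appendPoly, PowerSeries.coeff_one]

theorem kernel_mul_appendSeries :
    (1 - u * (1 + x) + 2 * u ^ 2 * x) * appendSeries =
      (1 - u * x + u ^ 2 * x) * inX avoiderSeries - u := by
  have e1 : (1 - u * (1 + x) + 2 * u ^ 2 * x) * appendSeries =
      PowerSeries.C (1 - Polynomial.X) * appendSeries +
        PowerSeries.C (2 * Polynomial.X ^ 2 - Polynomial.X) * (PowerSeries.X * appendSeries) := by
    simp only [u, x, map_sub, map_mul, map_pow, map_one, map_ofNat]
    ring
  have e2 : (1 - u * x + u ^ 2 * x) * inX avoiderSeries - u =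
      inX avoiderSeries - PowerSeries.C (Polynomial.X - Polynomial.X ^ 2) *
        (PowerSeries.X * inX avoiderSeries) - PowerSeries.C Polynomial.X := by
    simp only [u, x, map_sub, map_pow]
    ring
  rw [e1, e2]
  ext1 n
  rw [map_add, PowerSeries.coeff_C_mul, PowerSeries.coeff_C_mul, map_sub (PowerSeries.coeff n),
    map_sub (PowerSeries.coeff n), PowerSeries.coeff_C_mul]
  cases n with
  | zero => simp [appendSeries, inX, avoiderSeries, appendPoly_zero, ncard_avoiders_zero]
  | succ n =>
    simp only [PowerSeries.coeff_succ_X_mul, PowerSeries.coeff_C, appendSeries, inX, avoiderSeries,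
      PowerSeries.coeff_mk, PowerSeries.coeff_map, map_natCast, if_neg n.succ_ne_zero, sub_zero]
    exact one_sub_X_mul_appendPoly_succ n

/-! ### The kernel method -/

/-- The generating function of the large Schröder numbers, over `ℚ`. -/
noncomputable def schroderSeries : ℚ⟦X⟧ :=
  PowerSeries.map (Nat.castRingHom ℚ) PowerSeries.largeSchroderSeries

theorem schroderSeries_eq :
    schroderSeries = 1 + PowerSeries.X * schroderSeries + PowerSeries.X * schroderSeries ^ 2 := by
  have := congrArg (PowerSeries.map (Nat.castRingHom ℚ))
    PowerSeries.largeSchroderSeries_eq_one_add_X_mul_largeSchroderSeries_add_X_mul_largeSchroderSeries_sq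
  simpa [schroderSeries] using this

/-- If `1 - u α` divides a power series in `x` alone, where `α` is a power series in `x` alone with
constant term `1`, then the latter vanishes. -/
theorem eq_zero_of_one_sub_u_mul_eq_inX {α c : ℚ⟦X⟧} (hα : PowerSeries.constantCoeff α = 1)
    {E : ℚ[X]⟦X⟧} (hE : (1 - u * inX α) * E = inX c) : c = 0 := by
  -- This replaces the substitution `u = 1/α`. Once the lower coefficients of `E` vanish, the
  -- coefficient of `xⁿ` reads `(1 - u) Eₙ = cₙ` with `cₙ` free of `u`; setting `u = 1` gives `cₙ =
  -- 0`, hence `Eₙ = 0`.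
  have main : ∀ n, PowerSeries.coeff n E = 0 ∧ PowerSeries.coeff n c = 0 := by
    intro n
    induction n using Nat.strong_induction_on with
    | _ n ih =>
      have h1 := congrArg (PowerSeries.coeff n) hE
      rw [sub_mul, one_mul, u, mul_assoc, map_sub, PowerSeries.coeff_C_mul, PowerSeries.coeff_mul,
        Finset.sum_eq_single (0, n)] at h1
      · have h2 : PowerSeries.coeff 0 (inX α) = 1 := by simp [inX, hα]
        rw [h2, inX, PowerSeries.coeff_map, one_mul] at h1
        have h3 := congrArg (Polynomial.eval 1) h1
        simp only [Polynomial.eval_sub, Polynomial.eval_mul, Polynomial.eval_X, Polynomial.eval_C,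
          one_mul, sub_self] at h3
        refine ⟨?_, h3.symm⟩
        rw [← h3, map_zero] at h1
        have h4 : (1 - Polynomial.X) * PowerSeries.coeff n E = 0 := by linear_combination h1
        refine (mul_eq_zero.1 h4).resolve_left fun h5 => ?_
        simpa using congrArg (Polynomial.eval 0) h5
      · rintro ⟨i, j⟩ hij hne
        have hij' := Finset.HasAntidiagonal.mem_antidiagonal.1 hij
        rw [(ih j ?_).1, mul_zero]
        by_contra hj
        exact hne (by ext <;> simp at hij' ⊢ <;> omega)
      · intro h
        simp at h
  ext n
  exact (main n).2

theorem avoiderSeries_eq : avoiderSeries = 1 + PowerSeries.X * schroderSeries := by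
  set α : ℚ⟦X⟧ := 1 - PowerSeries.X * schroderSeries with hα
  have hα1 : PowerSeries.constantCoeff α = 1 := by simp [hα]
  -- Equivalently `α(1 + x - α) = 2x`, which is the factorization of the kernel.
  have hαq : α ^ 2 = (1 + PowerSeries.X) * α - 2 * PowerSeries.X := by
    rw [hα]
    linear_combination -PowerSeries.X * schroderSeries_eq
  have hαq' : inX α ^ 2 = (1 + x) * inX α - 2 * x := by
    have := congrArg inX hαq
    simp only [inX, map_sub, map_mul, map_add, map_one, map_pow, map_ofNat] at this
    simpa only [inX, x, PowerSeries.map_X] using this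
  have hD : inX ((α - PowerSeries.X) * (avoiderSeries - (2 - α))) =
      (inX α - x) * (inX avoiderSeries - (2 - inX α)) := by
    simp only [inX, x, map_sub, map_mul, map_ofNat, PowerSeries.map_X]
  -- At `u = 1/α`, the right side of the functional equation times `α²` is `(α - x)N - α`, with `N`
  -- the avoider series, and `α = (α - x)(2 - α)`. `E` is the corresponding quotient by `1 - uα`;
  -- the factor `α²` avoids inverting `α`.
  have key := eq_zero_of_one_sub_u_mul_eq_inX hα1
    (c := (α - PowerSeries.X) * (avoiderSeries - (2 - α)))
    (E := inX α ^ 2 * ((1 - u * (1 + x - inX α)) * appendSeries - ((2 - inX α) - u * (1 - inX α)))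
      - (inX avoiderSeries - (2 - inX α)) * (inX α * x - x * (u * inX α + 1))) (by
    rw [hD]
    have k := kernel_mul_appendSeries
    generalize inX α = a at *
    generalize inX avoiderSeries = N at *
    generalize appendSeries = G at *
    linear_combination a ^ 2 * k +
      (-a ^ 2 * u ^ 2 * G - a ^ 2 * (u - u ^ 2) + (N - (2 - a))) * hαq')
  have hne : α - PowerSeries.X ≠ 0 := fun h0 => by
    simpa [hα1] using congrArg PowerSeries.constantCoeff h0
  have := (mul_eq_zero.1 key).resolve_left hne
  rw [hα] at this
  linear_combination this

end LastEntry

theorem mainTheorem5 :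
    ∃ R : PowerSeries ℚ,
      -- `R` is the formal square root of `1 - 6x + x²`
      (R ^ 2 = 1 - 6 * PowerSeries.X + PowerSeries.X ^ 2 ∧ PowerSeries.constantCoeff R = 1) ∧
      -- the formula for `h(x,u)`
      (2 * (1 - LastEntry.u * (1 + LastEntry.x) + 2 * LastEntry.u ^ 2 * LastEntry.x) ≠ 0 ∧
        algebraMap _ (FractionRing (PowerSeries (Polynomial ℚ))) LastEntry.h =
          LastEntry.frac
            (2 * LastEntry.u * LastEntry.x * (1 - LastEntry.u) * (1 - LastEntry.u * LastEntry.x)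
              + LastEntry.u * LastEntry.x
                * (1 - LastEntry.u * (1 - LastEntry.u) * LastEntry.x)
                * (1 - LastEntry.x - LastEntry.inX R))
            (2 * (1 - LastEntry.u * (1 + LastEntry.x)
              + 2 * LastEntry.u ^ 2 * LastEntry.x))) ∧
      -- the formula for `h(x,1)`
      LastEntry.hAtOne = PowerSeries.C (1 / 2 : ℚ) * (1 - PowerSeries.X - R) ∧
      -- enumeration by the large Schröder numbers `1, 2, 6, 22, 90, …`
      ∀ n : ℕ, 1 ≤ n → (LastEntry.avoiders n).ncard = Nat.largeSchroder (n - 1) := by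
  have hden : 2 * (1 - LastEntry.u * (1 + LastEntry.x) + 2 * LastEntry.u ^ 2 * LastEntry.x)
      ≠ 0 := fun h0 => by
    have h1 := congrArg (fun f => (PowerSeries.constantCoeff f).eval 0) h0
    simp [LastEntry.u, LastEntry.x, map_ofNat PowerSeries.constantCoeff 2] at h1
  -- The root comes from solving the quadratic `xS² - (1 - x)S + 1 = 0`, whose discriminant is `1 -
  -- 6x + x²`, for `S`.
  refine ⟨1 - PowerSeries.X - 2 * (PowerSeries.X * LastEntry.schroderSeries), ⟨?_, by simp⟩,
    ⟨hden, ?_⟩, ?_, ?_⟩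
  · linear_combination -4 * PowerSeries.X * LastEntry.schroderSeries_eq
  · have hden' : algebraMap _ (FractionRing (PowerSeries (Polynomial ℚ)))
        (2 * (1 - LastEntry.u * (1 + LastEntry.x) + 2 * LastEntry.u ^ 2 * LastEntry.x)) ≠ 0 := by
      rwa [Ne, FaithfulSMul.algebraMap_eq_zero_iff]
    rw [LastEntry.frac, eq_div_iff hden', ← map_mul]
    congr 1
    have k := LastEntry.kernel_mul_appendSeries
    rw [LastEntry.avoiderSeries_eq] at k
    have e1 : LastEntry.inX (1 + PowerSeries.X * LastEntry.schroderSeries) =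
        1 + LastEntry.x * LastEntry.inX LastEntry.schroderSeries := by
      simp [LastEntry.inX, LastEntry.x]
    have e2 : LastEntry.inX
        (1 - PowerSeries.X - 2 * (PowerSeries.X * LastEntry.schroderSeries)) =
        1 - LastEntry.x - 2 * (LastEntry.x * LastEntry.inX LastEntry.schroderSeries) := by
      simp only [LastEntry.inX, LastEntry.x, map_sub, map_mul, map_one, map_ofNat,
        PowerSeries.map_X]
    rw [e1] at k
    rw [LastEntry.h_eq, e2]
    linear_combination 2 * LastEntry.u * LastEntry.x * k
  · rw [LastEntry.hAtOne_eq, LastEntry.avoiderSeries_eq]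
    have : (PowerSeries.C (1 / 2 : ℚ)) * 2 = 1 := by
      rw [← map_ofNat (PowerSeries.C (R := ℚ)) 2, ← map_mul]
      norm_num
    linear_combination -PowerSeries.X * LastEntry.schroderSeries * this
  · intro n hn
    obtain ⟨n, rfl⟩ := Nat.exists_eq_add_of_le' hn
    have := congrArg (PowerSeries.coeff (n + 1)) LastEntry.avoiderSeries_eq
    rw [map_add, PowerSeries.coeff_succ_X_mul] at this
    simpa [LastEntry.avoiderSeries, LastEntry.schroderSeries, PowerSeries.coeff_one] using this
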